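/- Let $\mathbb D=\{z\in\mathbb C:|z|<1\}$. A harmonic mapping $f=h+\overline g$ of $\mathbb D$ ($h,g$ analytic in $\mathbb D$) is called locally univalent if it is injective near every point of $\mathbb D$, and sense-preserving if its Jacobian is positive in $\mathbb D$; its dilatation is $\omega=g'/h'$. Let $\mathcal H$ be the class of all locally univalent and sense-preserving harmonic mappings $f=h+\overline g$ of $\mathbb D$ with $h(0)=0$ and $h'(0)=1$. A mapping $f$ is convex in the direction $\gamma\in\mathbb R$ if every line parallel to the line joining $0$ and $e^{i\gamma}$ meets $f(\mathbb D)$ in a connected (possibly empty) set. For $\mu,\nu\in\mathbb R$ put $\psi_{\mu,\nu}(z)=\bigl(1-2ze^{i\mu}\cos\nu+z^2e^{2i\mu}\bigr)^{-1}$, $z\in\mathbb D$. **Lemma.** Let $\mu,\nu\in\mathbb R$, and for $k=1,2$ let $f_k=h_k+\overline{g_k}\in\mathcal H$, with dilatation $\omega_k$, satisfy $$h_k(z)+e^{-2i\mu}g_k(z)=\int_0^z\psi_{\mu,\nu}(\xi)\,d\xi,\qquad z\in\mathbb D.$$ For $\eta\in\mathbb C$ let $\mathcal F_\eta=\eta f_1+(1-\eta)f_2$.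 (i) For every $\eta\in\mathbb C$ with $0\le\operatorname{Re}\eta\le1$: if $\mathcal F_\eta$ is locally univalent and sense-preserving in $\mathbb D$, then $\mathcal F_\eta$ is univalent in $\mathbb D$ and convex in the direction $-\mu$. (ii) Suppose that there are real numbers $\alpha_1\le 1/5$ and $\alpha_2\le1/7$ with $|\omega_k(z)|<\alpha_k$ for all $z\in\mathbb D$ and $k=1,2$. Then for every $\eta\in\mathbb C$ with $-1\le\operatorname{Re}\eta\le1$: if $\mathcal F_\eta$ is locally univalent and sense-preserving in $\mathbb D$, then $\mathcal F_\eta$ is univalent in $\mathbb D$ and convex in the direction $-\mu$. -/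

import Mathlib

open scoped ComplexConjugate

noncomputable section

namespace HarmonicShear

/-- The open unit disk of the complex plane. -/
def unitDisk : Set ℂ := Metric.ball 0 1

/-- The mapping `h + conj g` with analytic part `h` and co-analytic part `g`. -/
def harmonicMap (h g : ℂ → ℂ) : ℂ → ℂ := fun z => h z + conj (g z)

/-- The linear combination `η f₁ + (1 - η) f₂` with complex parameter `η`. -/
def linComb (η : ℂ) (f₁ f₂ : ℂ → ℂ) : ℂ → ℂ := fun z => η * f₁ z + (1 - η) * f₂ z

/-- The dilatation `g' / h'` of `h + conj g`. -/
def dilatation (h g : ℂ → ℂ) : ℂ → ℂ := fun z => deriv g z / deriv h z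

/-- The Jacobian of a planar mapping: the determinant of its real derivative. -/
def jacobian (f : ℂ → ℂ) (z : ℂ) : ℝ := (fderiv ℝ f z).det

/-- `f` is univalent (injective) on `U`. -/
def UnivalentOn (f : ℂ → ℂ) (U : Set ℂ) : Prop := Set.InjOn f U

/-- `f` is univalent in a neighbourhood of every point of the open set `U`. -/
def LocallyUnivalentOn (f : ℂ → ℂ) (U : Set ℂ) : Prop :=
  ∀ z ∈ U, ∃ V ∈ nhds z, V ⊆ U ∧ Set.InjOn f V

/-- `f` is sense-preserving on the open set `U`: its Jacobian is positive. -/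
def SensePreservingOn (f : ℂ → ℂ) (U : Set ℂ) : Prop :=
  ∀ z ∈ U, 0 < jacobian f z

/-- `f = h + conj g` belongs to the class of locally univalent and sense-preserving
harmonic mappings of the unit disk normalized by `h 0 = 0` and `h' 0 = 1`. -/
structure MemClassH (h g : ℂ → ℂ) : Prop where
  analytic_h : DifferentiableOn ℂ h unitDisk
  analytic_g : DifferentiableOn ℂ g unitDisk
  map_zero : h 0 = 0
  deriv_zero : deriv h 0 = 1
  locallyUnivalent : LocallyUnivalentOn (harmonicMap h g) unitDisk
  sensePreserving : SensePreservingOn (harmonicMap h g) unitDisk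

/-- The line through `a` parallel to the line joining the origin to `e^{iγ}`. -/
def lineInDirection (γ : ℝ) (a : ℂ) : Set ℂ :=
  Set.range fun t : ℝ => a + (t : ℂ) * Complex.exp (γ * Complex.I)

/-- `Ω` is convex in the direction `γ`: every line parallel to the line joining the origin
to `e^{iγ}` has connected (possibly empty) intersection with `Ω`. -/
def ConvexInDirection (γ : ℝ) (Ω : Set ℂ) : Prop :=
  ∀ a : ℂ, IsPreconnected (Ω ∩ lineInDirection γ a)

/-- `ψ_{μ,ν}(z) = (1 - 2 z e^{iμ} cos ν + z² e^{2iμ})⁻¹`. -/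
def psi (μ ν : ℝ) (z : ℂ) : ℂ :=
  (1 - 2 * z * Complex.exp (μ * Complex.I) * (Real.cos ν : ℂ)
    + z ^ 2 * Complex.exp (2 * μ * Complex.I))⁻¹

/-- The integral `∫_0^z p(ξ) dξ` along the segment from `0` to `z`. -/
def integralFromZero (p : ℂ → ℂ) (z : ℂ) : ℂ :=
  ∫ t in (0 : ℝ)..1, z * p (t * z)

end HarmonicShear

end

namespace HarmonicShear

open Complex Set Filter Topology

/-! Write the combination as `H + conj G`, where the co-analytic parts carry the weights `conj η`
and `1 - conj η`. Put `b_k = e^{-2iμ} g_k' / ψ`, so that the shear equation reads `h_k' / ψ = 1 -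
b_k`. Then `(H' - e^{-2iμ} G') / ψ = Re η (1 - 2 b₁) + (1 - Re η) (1 - 2 b₂)`: only the real part of
`η` survives. The bound `|b_k| < β |1 - b_k|` places `b_k` in a half-plane (`β = 1`) or a disk of
Apollonius (`β < 1`), which makes the real part of this expression positive in both cases of the
theorem.

That positivity suffices. A primitive of `ψ` straightens the rotated disk into a vertical strip or
half-plane, where, after rotation, the analytic function `K = A - B` has `Re K' > 0`. The central
fact is that the level sets of `Im K` are connected (`isPreconnected_im_level`). Since `Im K`
increases along verticals, a level set is a graph over a set of abscissae, and that set has no gaps: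
by Schwarz–Pick, `K` differs from its tangent approximation by at most a multiple of `Re K'`,
uniformly in height, and a convex combination of two such estimates cancels `Im K'`. So the image of
`K` is convex horizontally, and the Clunie–Sheil-Small shear transfers this, with injectivity, to `A
+ conj B`. -/

/-- Schwarz–Pick inequality for maps of a disk into the right half-plane. -/
theorem norm_deriv_le_of_re_pos {p : ℂ → ℂ} {a : ℂ} {r : ℝ} (hr : 0 < r)
    (hd : DifferentiableOn ℂ p (Metric.ball a r)) (hp : ∀ z ∈ Metric.ball a r, 0 < (p z).re) :
    ‖deriv p a‖ ≤ 2 / r * (p a).re := by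
  have ha : a ∈ Metric.ball a r := Metric.mem_ball_self hr
  have hpa := hp a ha
  have hne : ∀ z ∈ Metric.ball a r, p z + conj (p a) ≠ 0 := fun z hz h => by
    have := congrArg re h
    simp at this
    linarith [hp z hz]
  -- This Cayley transform sends the right half-plane into the disk and `p a` to `0`; its composite
  -- with `p` has derivative `p'(a) / (2 Re p(a))` at `a`, which Schwarz bounds by `1 / r`.
  have hq : DifferentiableOn ℂ (fun z => (p z - p a) / (p z + conj (p a))) (Metric.ball a r) :=
    (hd.sub_const _).div (hd.add_const _) hne
  have hmaps : MapsTo (fun z => (p z - p a) / (p z + conj (p a))) (Metric.ball a r)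
      (Metric.closedBall ((fun z => (p z - p a) / (p z + conj (p a))) a) 1) := by
    intro z hz
    have h2 : 0 < ‖p z + conj (p a)‖ := norm_pos_iff.2 (hne z hz)
    simp only [sub_self, zero_div, mem_closedBall_zero_iff, norm_div]
    rw [div_le_one h2, ← sq_le_sq₀ (norm_nonneg _) h2.le, ← normSq_eq_norm_sq, ← normSq_eq_norm_sq,
      normSq_apply, normSq_apply]
    simp only [sub_re, sub_im, add_re, add_im, conj_re, conj_im]
    nlinarith [mul_pos (hp z hz) hpa]
  have h := norm_deriv_le_div_of_mapsTo_ball hq hmaps hr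
  have hda : HasDerivAt p (deriv p a) a :=
    (hd.differentiableAt (Metric.isOpen_ball.mem_nhds ha)).hasDerivAt
  have hder := ((hda.sub_const (p a)).div (hda.add_const (conj (p a))) (hne a ha)).deriv
  have hsum : p a + conj (p a) = ((2 * (p a).re : ℝ) : ℂ) := by
    rw [add_conj]
  change deriv (fun z => (p z - p a) / (p z + conj (p a))) a = _ at hder
  rw [hder, sub_self, zero_mul, sub_zero, sq, mul_div_mul_right _ _ (hne a ha), hsum, norm_div,
    norm_real, Real.norm_of_nonneg (by linarith), div_le_iff₀ (by linarith)] at h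
  calc _ ≤ _ := h
    _ = _ := by ring

/-! ### Level sets of the imaginary part on a vertical strip -/

section Strip

variable {I : Set ℝ} {K p : ℂ → ℂ}

theorem isOpen_strip (hI : IsOpen I) : IsOpen {w : ℂ | w.re ∈ I} := hI.preimage continuous_re

theorem differentiableOn_strip_deriv (hI : IsOpen I)
    (hK : ∀ w : ℂ, w.re ∈ I → HasDerivAt K (p w) w) :
    DifferentiableOn ℂ p {w : ℂ | w.re ∈ I} := by
  have h1 : DifferentiableOn ℂ K {w : ℂ | w.re ∈ I} := fun w hw =>
    (hK w hw).differentiableAt.differentiableWithinAt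
  exact (h1.deriv (isOpen_strip hI)).congr fun w hw => (hK w hw).deriv.symm

/-- A primitive of a function with positive real part on a strip differs on two vertical lines
by its tangent approximation up to a uniform multiple of the real part of the derivative. -/
theorem exists_norm_sub_le_mul_re (hI : IsOpen I) (hconv : Convex ℝ I)
    (hK : ∀ w : ℂ, w.re ∈ I → HasDerivAt K (p w) w) (hp : ∀ w : ℂ, w.re ∈ I → 0 < (p w).re)
    {x x' : ℝ} (hx : x ∈ I) (hx' : x' ∈ I) :
    ∃ C : ℝ, ∀ y : ℝ, ‖K (x' + y * Complex.I) - K (x + y * Complex.I)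
      - (x' - x) * p (x + y * Complex.I)‖ ≤ C * (p (x + y * Complex.I)).re := by
  have hseg : segment ℝ x x' ⊆ I := hconv.segment_subset hx hx'
  have hcomp : IsCompact (segment ℝ x x') := by
    rw [segment_eq_uIcc]; exact isCompact_uIcc
  -- The strip is invariant under vertical translation, so one radius `r` serves every height `y`.
  obtain ⟨r, hr, hsub⟩ := hcomp.exists_thickening_subset_open hI hseg
  have hdp := differentiableOn_strip_deriv hI hK
  set v : ℝ := x' - x with hv
  -- The `+ 1` keeps `k` nonzero even if `x' = x`, as the explicit Grönwall bound requires.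
  set k : ℝ := |v| * (2 / r) + 1 with hk
  have hkpos : 0 < k := by positivity
  refine ⟨|v| * Real.exp k, fun y => ?_⟩
  set γ : ℝ → ℂ := fun t => ((x + t * v : ℝ) : ℂ) + y * Complex.I with hγ
  have hγre : ∀ t, (γ t).re = x + t * v := fun t => by simp [γ]
  have hmem : ∀ t ∈ Icc (0 : ℝ) 1, x + t * v ∈ segment ℝ x x' := fun t ht => by
    rw [segment_eq_image']
    exact ⟨t, ht, by simp [v]⟩
  have hball : ∀ t ∈ Icc (0 : ℝ) 1, ∀ z ∈ Metric.ball (γ t) r, z.re ∈ I := by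
    intro t ht z hz
    apply hsub
    rw [Metric.mem_thickening_iff]
    refine ⟨_, hmem t ht, ?_⟩
    rw [← hγre, Real.dist_eq, ← sub_re]
    exact (abs_re_le_norm _).trans_lt (by simpa [dist_eq_norm] using hz)
  have hγI : ∀ t ∈ Icc (0 : ℝ) 1, (γ t).re ∈ I := fun t ht =>
    hball t ht _ (Metric.mem_ball_self hr)
  have hγd : ∀ t, HasDerivAt γ (v : ℂ) t := fun t => by
    have h1 : HasDerivAt (fun t : ℝ => x + t * v) v t := by
      simpa using ((hasDerivAt_id t).mul_const v).const_add x
    exact h1.ofReal_comp.add_const _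
  have hSP : ∀ t ∈ Icc (0 : ℝ) 1, ‖deriv p (γ t)‖ ≤ 2 / r * (p (γ t)).re := fun t ht =>
    norm_deriv_le_of_re_pos hr (hdp.mono (hball t ht)) fun z hz => hp z (hball t ht z hz)
  have hNd : ∀ t ∈ Icc (0 : ℝ) 1,
      HasDerivAt (fun t => p (γ t) - p (γ 0)) (deriv p (γ t) * v) t := fun t ht =>
    ((((hdp.differentiableAt ((isOpen_strip hI).mem_nhds (hγI t ht))).hasDerivAt).comp t
      (hγd t)).sub_const _)
  have h0 : (0 : ℝ) ∈ Icc (0 : ℝ) 1 := by simp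
  have hP : 0 < (p (γ 0)).re := hp _ (hγI 0 h0)
  -- Grönwall for `N = p(γ t) - p(γ 0)`: since `Re p(γ t) ≤ |N| + Re p(γ 0)`, Schwarz–Pick gives
  -- `|N'| ≤ k |N| + k Re p(γ 0)`.
  have hN : ∀ t ∈ Icc (0 : ℝ) 1, ‖p (γ t) - p (γ 0)‖ ≤ Real.exp k * (p (γ 0)).re := by
    intro t ht
    have := norm_le_gronwallBound_of_norm_deriv_right_le
      (f := fun t => p (γ t) - p (γ 0)) (f' := fun t => deriv p (γ t) * v) (δ := 0) (K := k)
      (ε := k * (p (γ 0)).re) (a := 0) (b := 1)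
      (fun t ht => (hNd t ht).continuousAt.continuousWithinAt)
      (fun t ht => (hNd t (Ico_subset_Icc_self ht)).hasDerivWithinAt) (by simp)
      (fun t ht => by
        have ht' := Ico_subset_Icc_self ht
        have h1 : (p (γ t)).re ≤ ‖p (γ t) - p (γ 0)‖ + (p (γ 0)).re := by
          have := re_le_norm (p (γ t) - p (γ 0))
          rw [sub_re] at this
          linarith
        have h1' : 0 ≤ ‖p (γ t) - p (γ 0)‖ + (p (γ 0)).re := by positivity
        rw [norm_mul, norm_real, Real.norm_eq_abs]
        calc ‖deriv p (γ t)‖ * |v| ≤ (2 / r * (p (γ t)).re) * |v| := by gcongr; exact hSP t ht'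
          _ ≤ (2 / r * (‖p (γ t) - p (γ 0)‖ + (p (γ 0)).re)) * |v| := by gcongr
          _ ≤ k * ‖p (γ t) - p (γ 0)‖ + k * (p (γ 0)).re := by rw [hk]; linarith)
      t ht
    refine this.trans ((gronwallBound_mono le_rfl (by positivity) hkpos.le
      (by linarith [ht.2] : t - 0 ≤ 1)).trans ?_)
    rw [gronwallBound_of_K_ne_0 hkpos.ne', mul_div_cancel_left₀ _ hkpos.ne']
    simp only [zero_mul, zero_add, mul_one]
    linarith
  have hM := norm_image_sub_le_of_norm_deriv_le_segment_01'
    (f := fun t : ℝ => K (γ t) - t * (v * p (γ 0)))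
    (f' := fun t => p (γ t) * v - v * p (γ 0)) (C := |v| * Real.exp k * (p (γ 0)).re)
    (fun t ht => by
      have h1 : HasDerivAt (fun t : ℝ => (t : ℂ) * (v * p (γ 0))) (v * p (γ 0)) t := by
        simpa using ((hasDerivAt_id t).ofReal_comp.mul_const (v * p (γ 0)))
      exact ((((hK _ (hγI t ht)).comp t (hγd t))).sub h1).hasDerivWithinAt)
    (fun t ht => by
      have : p (γ t) * v - v * p (γ 0) = v * (p (γ t) - p (γ 0)) := by ring
      rw [this, norm_mul, norm_real, Real.norm_eq_abs, mul_assoc]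
      gcongr
      exact hN t (Ico_subset_Icc_self ht))
  have e0 : γ 0 = x + y * Complex.I := by simp [γ]
  have e1 : γ 1 = x' + y * Complex.I := by simp [γ, v]
  simp only [e0, e1, ofReal_one, ofReal_zero, one_mul, zero_mul, sub_zero] at hM
  rw [sub_right_comm, ← ofReal_sub]
  exact hM

/-- Moving vertically multiplies the derivative by `i`, and `Im (i p) = Re p`. -/
theorem hasDerivAt_im_vertical (hK : ∀ w : ℂ, w.re ∈ I → HasDerivAt K (p w) w) {x : ℝ} (hx : x ∈ I)
    (y : ℝ) : HasDerivAt (fun y : ℝ => (K (x + y * Complex.I)).im)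
      (p (x + y * Complex.I)).re y := by
  have h1 : HasDerivAt (fun y : ℝ => (x : ℂ) + y * Complex.I) Complex.I y := by
    simpa using (((hasDerivAt_id y).ofReal_comp).mul_const Complex.I).const_add (x : ℂ)
  have h2 := (hK (x + y * Complex.I) (by simpa using hx)).comp y h1
  have h3 := (imCLM.hasFDerivAt (x := K (x + y * Complex.I))).comp_hasDerivAt y h2
  rw [imCLM_apply, mul_I_im] at h3
  exact h3

theorem strictMono_im_vertical (hK : ∀ w : ℂ, w.re ∈ I → HasDerivAt K (p w) w)
    (hp : ∀ w : ℂ, w.re ∈ I → 0 < (p w).re) {x : ℝ} (hx : x ∈ I) :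
    StrictMono fun y : ℝ => (K (x + y * Complex.I)).im :=
  strictMono_of_deriv_pos fun y => by
    rw [(hasDerivAt_im_vertical hK hx y).deriv]
    exact hp _ (by simpa using hx)

/-- The abscissae over which the imaginary part exceeds a given level form a convex set. -/
theorem exists_lt_im_of_between (hI : IsOpen I) (hconv : Convex ℝ I)
    (hK : ∀ w : ℂ, w.re ∈ I → HasDerivAt K (p w) w) (hp : ∀ w : ℂ, w.re ∈ I → 0 < (p w).re)
    {x₁ x₂ c y₀ : ℝ} (hx₁ : x₁ ∈ I) (hx₂ : x₂ ∈ I) (h₁ : c < (K (x₁ + y₀ * Complex.I)).im)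
    (h₂ : c < (K (x₂ + y₀ * Complex.I)).im) {x : ℝ} (hx : x ∈ segment ℝ x₁ x₂) :
    ∃ y : ℝ, c < (K (x + y * Complex.I)).im := by
  have hxI : x ∈ I := hconv.segment_subset hx₁ hx₂ hx
  obtain ⟨a, b, ha, hb, hab, rfl⟩ := hx
  simp only [smul_eq_mul] at *
  set x : ℝ := a * x₁ + b * x₂ with hx
  by_contra! hle
  obtain ⟨C₁, hC₁⟩ := exists_norm_sub_le_mul_re hI hconv hK hp hxI hx₁
  obtain ⟨C₂, hC₂⟩ := exists_norm_sub_le_mul_re hI hconv hK hp hxI hx₂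
  obtain ⟨ε, hε, hε₁, hε₂⟩ : ∃ ε > 0, c + ε ≤ (K (x₁ + y₀ * Complex.I)).im ∧
      c + ε ≤ (K (x₂ + y₀ * Complex.I)).im :=
    ⟨min ((K (x₁ + y₀ * Complex.I)).im - c) ((K (x₂ + y₀ * Complex.I)).im - c),
      lt_min (by linarith) (by linarith), le_sub_iff_add_le'.1 (min_le_left _ _),
      le_sub_iff_add_le'.1 (min_le_right _ _)⟩
  set C : ℝ := |C₁| + |C₂| + 1 with hC
  have hCpos : 0 < C := by positivity
  -- Above height `y₀` both outer lines stay at level at least `c + ε` while the middle one stays at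
  -- most `c`. Weighting the two tangent estimates by `a` and `b` cancels the `Im p` terms and
  -- leaves `ε ≤ C Re p`.
  have hlow : ∀ y : ℝ, y₀ ≤ y → ε / C ≤ (p (x + y * Complex.I)).re := by
    intro y hy
    have hP : 0 < (p (x + y * Complex.I)).re := hp _ (by simpa using hxI)
    have m₁ := (strictMono_im_vertical hK hp hx₁).monotone hy
    have m₂ := (strictMono_im_vertical hK hp hx₂).monotone hy
    have i₁ := (im_le_norm _).trans (hC₁ y)
    have i₂ := (im_le_norm _).trans (hC₂ y)
    have hl := hle y
    simp only [sub_im, mul_im, sub_re, ofReal_re, ofReal_im, sub_self, zero_mul, add_zero]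
      at i₁ i₂ m₁ m₂
    set P := (p (x + y * Complex.I)).re
    set Q := (p (x + y * Complex.I)).im
    have j₁ : C₁ * P ≤ |C₁| * P := by gcongr; exact le_abs_self _
    have j₂ : C₂ * P ≤ |C₂| * P := by gcongr; exact le_abs_self _
    have k₁ : c + ε ≤ c + (x₁ - x) * Q + |C₁| * P := by linarith
    have k₂ : c + ε ≤ c + (x₂ - x) * Q + |C₂| * P := by linarith
    have l₁ := mul_le_mul_of_nonneg_left k₁ ha
    have l₂ := mul_le_mul_of_nonneg_left k₂ hb
    have ha1 : a ≤ 1 := by linarith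
    have hb1 : b ≤ 1 := by linarith
    have n₁ : a * (|C₁| * P) ≤ 1 * (|C₁| * P) := by gcongr
    have n₂ : b * (|C₂| * P) ≤ 1 * (|C₂| * P) := by gcongr
    have e : a * ((x₁ - x) * Q) + b * ((x₂ - x) * Q) = 0 := by
      have : b = 1 - a := by linarith
      rw [hx, this]; ring
    have e2 : a * (c + ε) + b * (c + ε) = c + ε := by rw [← add_mul, hab, one_mul]
    have e3 : a * c + b * c = c := by rw [← add_mul, hab, one_mul]
    rw [div_le_iff₀ hCpos, hC]
    linarith
  have hg := (convex_Ici y₀).mul_sub_le_image_sub_of_le_deriv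
    (f := fun y : ℝ => (K (x + y * Complex.I)).im) (C := ε / C)
    (fun y _ => (hasDerivAt_im_vertical hK hxI y).continuousAt.continuousWithinAt)
    (fun y _ => (hasDerivAt_im_vertical hK hxI y).differentiableAt.differentiableWithinAt)
    (fun y hy => by
      rw [interior_Ici] at hy
      rw [(hasDerivAt_im_vertical hK hxI y).deriv]
      exact hlow y (le_of_lt hy))
  have hεC : 0 < ε / C := by positivity
  -- A rise by `D` at slope at least `ε / C` lifts the imaginary part above `c`, contradicting
  -- `hle`.
  set D : ℝ := (|c - (K (x + y₀ * Complex.I)).im| + 1) / (ε / C) with hD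
  have hD0 : 0 ≤ D := by positivity
  have h3 := hg y₀ self_mem_Ici (y₀ + D) (mem_Ici.2 (by linarith)) (by linarith)
  have h4 : ε / C * D = |c - (K (x + y₀ * Complex.I)).im| + 1 := by
    rw [hD]; field_simp
  rw [add_sub_cancel_left, h4] at h3
  linarith [hle (y₀ + D), le_abs_self (c - (K (x + y₀ * Complex.I)).im)]

/-- The abscissae over which the imaginary part is below a given level form a convex set. -/
theorem exists_im_lt_of_between (hI : IsOpen I) (hconv : Convex ℝ I)
    (hK : ∀ w : ℂ, w.re ∈ I → HasDerivAt K (p w) w) (hp : ∀ w : ℂ, w.re ∈ I → 0 < (p w).re)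
    {x₁ x₂ c y₀ : ℝ} (hx₁ : x₁ ∈ I) (hx₂ : x₂ ∈ I) (h₁ : (K (x₁ + y₀ * Complex.I)).im < c)
    (h₂ : (K (x₂ + y₀ * Complex.I)).im < c) {x : ℝ} (hx : x ∈ segment ℝ x₁ x₂) :
    ∃ y : ℝ, (K (x + y * Complex.I)).im < c := by
  have e : ∀ s t : ℝ, -(((-s : ℝ) : ℂ) + ((-t : ℝ) : ℂ) * Complex.I) = s + t * Complex.I := by
    intro s t; push_cast; ring
  -- The reflection `w ↦ -K(-w)` has derivative `p(-w)`, so it preserves positivity and exchanges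
  -- above and below.
  have hK' : ∀ w : ℂ, w.re ∈ Neg.neg ⁻¹' I → HasDerivAt (fun w => -K (-w)) (p (-w)) w := by
    intro w hw
    have h := ((hK (-w) (by simpa using hw)).comp w (hasDerivAt_neg w)).neg
    rw [mul_neg_one, neg_neg] at h
    exact h
  obtain ⟨y, hy⟩ := exists_lt_im_of_between (I := Neg.neg ⁻¹' I) (K := fun w => -K (-w))
    (p := fun w => p (-w)) (x₁ := -x₁) (x₂ := -x₂) (x := -x) (c := -c) (y₀ := -y₀)
    (hI.preimage continuous_neg) (hconv.is_linear_preimage IsLinearMap.isLinearMap_neg) hK'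
    (fun w hw => hp _ (by simpa using hw)) (by simpa using hx₁) (by simpa using hx₂)
    (by simp only [e, neg_im]; linarith) (by simp only [e, neg_im]; linarith)
    (by
      obtain ⟨a, b, ha, hb, hab, rfl⟩ := hx
      exact ⟨a, b, ha, hb, hab, by simp only [smul_eq_mul]; ring⟩)
  refine ⟨-y, ?_⟩
  have := e x (-y)
  rw [neg_neg] at this
  simp only [neg_im, this] at hy
  linarith

/-- Level sets of the imaginary part are connected. -/
theorem isPreconnected_im_level (hI : IsOpen I) (hconv : Convex ℝ I)
    (hK : ∀ w : ℂ, w.re ∈ I → HasDerivAt K (p w) w) (hp : ∀ w : ℂ, w.re ∈ I → 0 < (p w).re)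
    (c : ℝ) : IsPreconnected {w : ℂ | w.re ∈ I ∧ (K w).im = c} := by
  set X : Set ℝ := {x | x ∈ I ∧ ∃ y : ℝ, (K (x + y * Complex.I)).im = c} with hX
  have hmono := fun {x : ℝ} (hx : x ∈ I) => strictMono_im_vertical hK hp hx
  have hXc : Convex ℝ X := by
    rw [convex_iff_segment_subset]
    rintro x₁ ⟨hx₁, y₁, e₁⟩ x₂ ⟨hx₂, y₂, e₂⟩ x hx
    have hxI : x ∈ I := hconv.segment_subset hx₁ hx₂ hx
    obtain ⟨u, hu⟩ := exists_lt_im_of_between hI hconv hK hp (c := c) (y₀ := max y₁ y₂ + 1) hx₁ hx₂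
      (by rw [← e₁]; exact hmono hx₁ (by linarith [le_max_left y₁ y₂]))
      (by rw [← e₂]; exact hmono hx₂ (by linarith [le_max_right y₁ y₂])) hx
    obtain ⟨l, hl⟩ := exists_im_lt_of_between hI hconv hK hp (c := c) (y₀ := min y₁ y₂ - 1) hx₁ hx₂
      (by rw [← e₁]; exact hmono hx₁ (by linarith [min_le_left y₁ y₂]))
      (by rw [← e₂]; exact hmono hx₂ (by linarith [min_le_right y₁ y₂])) hx
    have hcont : Continuous fun y : ℝ => (K (x + y * Complex.I)).im :=
      continuous_iff_continuousAt.2 fun y => (hasDerivAt_im_vertical hK hxI y).continuousAt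
    exact ⟨hxI, mem_range_of_exists_le_of_exists_ge hcont ⟨l, hl.le⟩ ⟨u, hu.le⟩⟩
  choose! φ hφ using fun x (hx : x ∈ X) => hx.2
  -- The strict inequalities at `φ x₀ ± ε` persist for nearby abscissae, and vertical monotonicity
  -- traps `φ x` between these heights.
  have hφc : ContinuousOn φ X := by
    intro x₀ hx₀
    rw [ContinuousWithinAt, Metric.tendsto_nhds]
    intro ε hε
    have hKc : ∀ y : ℝ, ContinuousAt (fun x : ℝ => (K (x + y * Complex.I)).im) x₀ := fun y => by
      have h1 : ContinuousAt K ((x₀ : ℂ) + y * Complex.I) :=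
        (hK _ (by simpa using hx₀.1)).continuousAt
      have h2 : ContinuousAt (fun x : ℝ => (x : ℂ) + y * Complex.I) x₀ := by fun_prop
      exact continuous_im.continuousAt.comp
        (ContinuousAt.comp (f := fun x : ℝ => (x : ℂ) + y * Complex.I) h1 h2)
    have l : (K (x₀ + (φ x₀ - ε : ℝ) * Complex.I)).im < c := by
      conv_rhs => rw [← hφ x₀ hx₀]
      exact hmono hx₀.1 (by linarith)
    have u : c < (K (x₀ + (φ x₀ + ε : ℝ) * Complex.I)).im := by
      conv_lhs => rw [← hφ x₀ hx₀]
      exact hmono hx₀.1 (by linarith)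
    filter_upwards [nhdsWithin_le_nhds ((hKc _).eventually (gt_mem_nhds l)),
      nhdsWithin_le_nhds ((hKc _).eventually (lt_mem_nhds u)), self_mem_nhdsWithin] with x hl hu hx
    rw [← hφ x hx] at hl hu
    have hl' := (hmono hx.1).lt_iff_lt.1 hl
    have hu' := (hmono hx.1).lt_iff_lt.1 hu
    rw [Real.dist_eq, abs_lt]
    constructor <;> linarith
  have himg : {w : ℂ | w.re ∈ I ∧ (K w).im = c} = (fun x : ℝ => (x + φ x * Complex.I : ℂ)) '' X := by
    ext w
    constructor
    · rintro ⟨hw, hc⟩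
      have hwX : w.re ∈ X := ⟨hw, w.im, by rw [re_add_im]; exact hc⟩
      refine ⟨w.re, hwX, ?_⟩
      have h1 : (K (w.re + w.im * Complex.I)).im = c := by rw [re_add_im]; exact hc
      have : φ w.re = w.im := (hmono hw).injective ((hφ _ hwX).trans h1.symm)
      simp only [this, re_add_im]
    · rintro ⟨x, hx, rfl⟩
      exact ⟨by simpa using hx.1, hφ x hx⟩
  rw [himg]
  refine hXc.isPreconnected.image _ ?_
  exact continuous_ofReal.continuousOn.add
    ((continuous_ofReal.comp_continuousOn hφc).mul continuousOn_const)

end Strip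

/-! ### Univalence and shearing on a strip -/

section Strip

variable {I : Set ℝ} {A B a b : ℂ → ℂ}

/-- Noshiro–Warschawski on a strip. -/
theorem injOn_of_re_deriv_pos {K p : ℂ → ℂ} (hconv : Convex ℝ I)
    (hK : ∀ w : ℂ, w.re ∈ I → HasDerivAt K (p w) w) (hp : ∀ w : ℂ, w.re ∈ I → 0 < (p w).re) :
    InjOn K {w : ℂ | w.re ∈ I} := by
  intro w₁ h₁ w₂ h₂ heq
  by_contra hne
  set v : ℂ := w₂ - w₁ with hv
  have hv0 : 0 < normSq v := normSq_pos.2 (sub_ne_zero.2 (Ne.symm hne))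
  have hmem : ∀ t ∈ Icc (0 : ℝ) 1, (w₁ + t * v).re ∈ I := fun t ht => by
    have : (w₁ + t * v).re = (1 - t) • w₁.re + t • w₂.re := by simp [v]; ring
    rw [this]
    exact hconv h₁ h₂ (by linarith [ht.2]) ht.1 (by ring)
  -- Projecting `K` onto the direction `v` of the chord gives a real function with derivative `|v|²
  -- Re p > 0`.
  have hd : ∀ t ∈ Icc (0 : ℝ) 1, HasDerivAt (fun t : ℝ => (conj v * K (w₁ + t * v)).re)
      (normSq v * (p (w₁ + t * v)).re) t := by
    intro t ht
    have h1 : HasDerivAt (fun t : ℝ => w₁ + t * v) v t := by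
      simpa using (((hasDerivAt_id t).ofReal_comp).mul_const v).const_add w₁
    have h2 := ((hK _ (hmem t ht)).comp t h1).const_mul (conj v)
    have h3 := (reCLM.hasFDerivAt (x := conj v * K (w₁ + t * v))).comp_hasDerivAt t h2
    have e : conj v * (p (w₁ + t * v) * v) = (normSq v : ℂ) * p (w₁ + t * v) := by
      rw [normSq_eq_conj_mul_self]; ring
    rw [reCLM_apply, e, re_ofReal_mul] at h3
    exact h3
  have hm := strictMonoOn_of_deriv_pos (convex_Icc (0 : ℝ) 1)
    (f := fun t : ℝ => (conj v * K (w₁ + t * v)).re)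
    (fun t ht => (hd t ht).continuousAt.continuousWithinAt)
    (fun t ht => by
      rw [(hd t (interior_subset ht)).deriv]
      exact mul_pos hv0 (hp _ (hmem t (interior_subset ht))))
  have h := hm (left_mem_Icc.2 zero_le_one) (right_mem_Icc.2 zero_le_one) zero_lt_one
  simp [v, heq] at h

/-- Shear construction on a strip. If `A - B` has derivative with positive real part and
`|B'| < |A'|`, then `A + conj B` is injective and every horizontal line meets its range in a
connected set. -/
theorem injOn_and_isPreconnected_of_strip (hI : IsOpen I) (hconv : Convex ℝ I)
    (hA : ∀ w : ℂ, w.re ∈ I → HasDerivAt A (a w) w)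
    (hB : ∀ w : ℂ, w.re ∈ I → HasDerivAt B (b w) w)
    (hab : ∀ w : ℂ, w.re ∈ I → ‖b w‖ < ‖a w‖)
    (hp : ∀ w : ℂ, w.re ∈ I → 0 < (a w - b w).re) :
    InjOn (fun w => A w + conj (B w)) {w : ℂ | w.re ∈ I} ∧
      ∀ c : ℝ, IsPreconnected
        ((fun w => A w + conj (B w)) '' {w : ℂ | w.re ∈ I} ∩ {z | z.im = c}) := by
  set S : Set ℂ := {w : ℂ | w.re ∈ I} with hS
  have hSo : IsOpen S := isOpen_strip hI
  set K : ℂ → ℂ := fun w => A w - B w with hKdef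
  have hK : ∀ w : ℂ, w.re ∈ I → HasDerivAt K (a w - b w) w := fun w hw => (hA w hw).sub (hB w hw)
  have hinj : InjOn K S := injOn_of_re_deriv_pos hconv hK hp
  have hKc : ContinuousOn K S := fun w hw => (hK w hw).continuousAt.continuousWithinAt
  set κ : ℂ → ℂ := Function.invFunOn K S with hκ
  have hκK : ∀ w ∈ S, κ (K w) = w := fun w hw => hinj.leftInvOn_invFunOn hw
  have hκd : ∀ w ∈ S, HasDerivAt κ (a w - b w)⁻¹ (K w) := by
    intro w hw
    have hne : a w - b w ≠ 0 := fun h => by simpa [h] using hp w hw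
    have hd : DifferentiableOn ℂ K S := fun z hz => (hK z hz).differentiableAt.differentiableWithinAt
    have hs : HasStrictDerivAt K (a w - b w) w := by
      rw [← (hK w hw).deriv]
      exact (hd.analyticAt (hSo.mem_nhds hw)).hasStrictDerivAt
    exact (hs.to_local_left_inverse hne
      (Filter.eventually_of_mem (hSo.mem_nhds hw) hκK)).hasDerivAt
  set f : ℂ → ℂ := fun w => A w + conj (B w) with hf
  have hfim : ∀ w, (f w).im = (K w).im := fun w => by simp [f, K, sub_eq_add_neg]
  have hfre : ∀ w, (f w).re = (A w + B w).re := fun w => by simp [f]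
  set J : ℝ → Set ℝ := fun c => re '' (K '' {w : ℂ | w.re ∈ I ∧ (K w).im = c}) with hJ
  have hJmem : ∀ {c t}, t ∈ J c → ∃ w ∈ S, K w = t + c * Complex.I := by
    rintro c t ⟨_, ⟨w, ⟨hw, hc⟩, rfl⟩, rfl⟩
    exact ⟨w, hw, by rw [← hc, re_add_im]⟩
  have hmemJ : ∀ {w}, w ∈ S → (K w).re ∈ J (K w).im := fun {w} hw =>
    ⟨_, ⟨w, ⟨hw, rfl⟩, rfl⟩, rfl⟩
  have hJpre : ∀ c, IsPreconnected (J c) := fun c =>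
    ((isPreconnected_im_level hI hconv hK hp c).image K
      (hKc.mono fun w hw => hw.1)).image re continuous_re.continuousOn
  -- As `A + conj B` and `K` have the same imaginary part, `f ∘ K⁻¹` preserves each horizontal slice
  -- `J c` and acts on it as the real function `U c`.
  set U : ℝ → ℝ → ℝ := fun c t => (A (κ (t + c * Complex.I)) + B (κ (t + c * Complex.I))).re with hU
  have hUd : ∀ c t, t ∈ J c → ∃ d, 0 < d ∧ HasDerivAt (U c) d t := by
    intro c t ht
    obtain ⟨w, hw, hwt⟩ := hJmem ht
    have hκw : κ (t + c * Complex.I) = w := by rw [← hwt, hκK w hw]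
    have h1 : HasDerivAt (fun t : ℝ => (t : ℂ) + c * Complex.I) 1 t :=
      ((hasDerivAt_id t).ofReal_comp).add_const _
    have h2 : HasDerivAt κ (a w - b w)⁻¹ (t + c * Complex.I) := hwt ▸ hκd w hw
    have h3 : HasDerivAt (fun w => A w + B w) (a w + b w) (κ (t + c * Complex.I)) := by
      rw [hκw]; exact (hA w hw).add (hB w hw)
    have h4 := (h3.comp _ h2).comp t h1
    have h5 := (reCLM.hasFDerivAt
      (x := A (κ (t + c * Complex.I)) + B (κ (t + c * Complex.I)))).comp_hasDerivAt t h4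
    refine ⟨_, ?_, h5⟩
    have hpos : 0 < normSq (a w - b w) := normSq_pos.2 fun h => by simpa [h] using hp w hw
    have hlt : normSq (b w) < normSq (a w) := by
      rw [normSq_eq_norm_sq, normSq_eq_norm_sq]
      exact pow_lt_pow_left₀ (hab w hw) (norm_nonneg _) two_ne_zero
    -- The slope is `Re ((a + b) / (a - b)) = (|a|² - |b|²) / |a - b|²`.
    rw [reCLM_apply, mul_one, ← div_eq_mul_inv, div_re, ← add_div]
    refine div_pos ?_ hpos
    rw [normSq_apply, normSq_apply] at hlt
    simp only [add_re, add_im, sub_re, sub_im]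
    linarith
  have hUmono : ∀ c, StrictMonoOn (U c) (J c) := fun c =>
    strictMonoOn_of_deriv_pos (hJpre c).ordConnected.convex
      (fun t ht => by
        obtain ⟨d, -, hd⟩ := hUd c t ht
        exact hd.continuousAt.continuousWithinAt)
      (fun t ht => by
        obtain ⟨d, hd0, hd⟩ := hUd c t (interior_subset ht)
        rwa [hd.deriv])
  have hUf : ∀ w ∈ S, U (K w).im (K w).re = (f w).re := fun w hw => by
    simp only [U, re_add_im, hκK w hw, hfre]
  constructor
  · intro w₁ h₁ w₂ h₂ heq
    have him : (K w₁).im = (K w₂).im := by rw [← hfim, ← hfim]; exact congrArg im heq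
    have hre : U (K w₁).im (K w₁).re = U (K w₁).im (K w₂).re := by
      rw [hUf w₁ h₁, him, hUf w₂ h₂]; exact congrArg re heq
    have := (hUmono (K w₁).im).injOn (hmemJ h₁) (by rw [him]; exact hmemJ h₂) hre
    exact hinj h₁ h₂ (Complex.ext this him)
  · intro c
    have himg : f '' S ∩ {z | z.im = c} = (fun t : ℝ => (U c t + c * Complex.I : ℂ)) '' J c := by
      ext z
      constructor
      · rintro ⟨⟨w, hw, rfl⟩, hz⟩
        have hc : (K w).im = c := by rw [← hfim]; exact hz
        refine ⟨(K w).re, hc ▸ hmemJ hw, ?_⟩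
        have h1 : U c (K w).re = (f w).re := hc ▸ hUf w hw
        have h2 : (f w).im = c := hz
        exact Complex.ext (by simp [h1]) (by simp [h2])
      · rintro ⟨t, ht, rfl⟩
        obtain ⟨w, hw, hwt⟩ := hJmem ht
        have hre : (K w).re = t := by simp [hwt]
        have him : (K w).im = c := by simp [hwt]
        refine ⟨⟨w, hw, ?_⟩, by simp⟩
        have h1 := hUf w hw
        rw [hre, him] at h1
        have h2 : (f w).im = c := by rw [hfim, him]
        exact Complex.ext (by simp [h1]) (by simp [h2])
    rw [himg]
    refine (hJpre c).image _ fun t ht => ?_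
    obtain ⟨d, -, hd⟩ := hUd c t ht
    have : ContinuousAt (U c) t := hd.continuousAt
    exact ((continuous_ofReal.continuousAt.comp this).add continuousAt_const).continuousWithinAt

end Strip

/-! ### Straightening the disk by a primitive of `ψ` -/

/-- The denominator of `psi 0 ν` factors over the unit circle and does not vanish in the disk. -/
theorem quadratic_ne_zero (ν : ℝ) {z : ℂ} (hz : ‖z‖ < 1) :
    1 - 2 * z * (Real.cos ν : ℂ) + z ^ 2 ≠ 0 := by
  have e : 1 - 2 * z * (Real.cos ν : ℂ) + z ^ 2
      = (1 - z * exp (ν * Complex.I)) * (1 - z * exp (-(ν * Complex.I))) := by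
    have h1 : exp (ν * Complex.I) * exp (-(ν * Complex.I)) = 1 := by rw [← exp_add]; simp
    have h2 : (Real.cos ν : ℂ) = (exp (ν * Complex.I) + exp (-(ν * Complex.I))) / 2 := by
      rw [ofReal_cos, Complex.cos, neg_mul]
    rw [h2]
    linear_combination (-z ^ 2) * h1
  have key : ∀ u : ℂ, ‖u‖ = 1 → 1 - z * u ≠ 0 := fun u hu h => by
    have : ‖z * u‖ = 1 := by rw [← sub_eq_zero.1 h, norm_one]
    rw [norm_mul, hu, mul_one] at this
    linarith
  rw [e]
  refine mul_ne_zero (key _ (norm_exp_ofReal_mul_I ν)) (key _ ?_)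
  have := norm_exp_ofReal_mul_I (-ν)
  rwa [ofReal_neg, neg_mul] at this

/-- A parametrization of the disk by a vertical strip or half-plane which inverts a
primitive of `psi 0 ν`, up to an affine change of variable. -/
theorem exists_strip_parametrization (ν : ℝ) :
    ∃ (I : Set ℝ) (c : ℝ) (Φ : ℂ → ℂ), IsOpen I ∧ Convex ℝ I ∧ 0 < c ∧
      (∀ w : ℂ, w.re ∈ I → HasDerivAt Φ (c * (1 - 2 * Φ w * (Real.cos ν : ℂ) + Φ w ^ 2)) w) ∧
      (∀ w : ℂ, w.re ∈ I → ‖Φ w‖ < 1) ∧ ∀ z : ℂ, ‖z‖ < 1 → ∃ w : ℂ, w.re ∈ I ∧ Φ w = z := by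
  have hlt : ∀ u v : ℂ, normSq u < normSq v → ‖u / v‖ < 1 := by
    intro u v h
    have hv : 0 < ‖v‖ := by
      rw [norm_pos_iff, ← normSq_pos]; exact (normSq_nonneg u).trans_lt h
    rw [norm_div, div_lt_one hv]
    rw [normSq_eq_norm_sq, normSq_eq_norm_sq] at h
    exact lt_of_pow_lt_pow_left₀ 2 hv.le h
  have hsq : ∀ z : ℂ, ‖z‖ < 1 → z.re * z.re + z.im * z.im < 1 := by
    intro z hz
    rw [← normSq_apply, normSq_eq_norm_sq]
    exact pow_lt_one₀ (norm_nonneg _) hz two_ne_zero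
  -- Only `cos ν` matters; this representative lies in `[0, π]`, so its sine is nonnegative. The
  -- endpoints give half-planes, the interior a strip.
  set θ := Real.arccos (Real.cos ν) with hθ
  have hcos : Real.cos θ = Real.cos ν := Real.cos_arccos (Real.neg_one_le_cos ν) (Real.cos_le_one ν)
  rw [← hcos]
  rcases (Real.arccos_nonneg (Real.cos ν)).eq_or_lt with h0 | h0
  · have h1 : Real.cos θ = 1 := by rw [hθ, ← h0, Real.cos_zero]
    have hne : ∀ w : ℂ, w.re ∈ Ioi (-1 / 2 : ℝ) → 1 + w ≠ 0 := fun w hw h => by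
      have := congrArg re h
      simp at this hw
      linarith
    refine ⟨Ioi (-1 / 2), 1, fun w => w / (1 + w), isOpen_Ioi, convex_Ioi _, one_pos, ?_, ?_, ?_⟩
    · intro w hw
      have h2 := hne w hw
      refine ((hasDerivAt_id w).div ((hasDerivAt_id w).const_add 1) h2).congr_deriv ?_
      rw [h1]; simp only [id]; push_cast; field_simp; ring
    · intro w hw
      apply hlt
      simp only [normSq_apply, add_re, one_re, add_im, one_im]
      have : -1 / 2 < w.re := hw
      linarith
    · intro z hz
      have hz1 := hsq z hz
      have h2 : 1 - z ≠ 0 := fun h => by rw [← sub_eq_zero.1 h, norm_one] at hz; exact lt_irrefl _ hz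
      refine ⟨z / (1 - z), ?_, ?_⟩
      · have hn : 0 < normSq (1 - z) := normSq_pos.2 h2
        rw [mem_Ioi, div_re, ← add_div, lt_div_iff₀ hn, normSq_apply]
        simp only [sub_re, sub_im, one_re, one_im]
        linarith
      · field_simp; ring
  rcases (Real.arccos_le_pi (Real.cos ν)).eq_or_lt with hpi | hpi
  · have h1 : Real.cos θ = -1 := by rw [hθ, hpi, Real.cos_pi]
    have hne : ∀ w : ℂ, w.re ∈ Iio (1 / 2 : ℝ) → 1 - w ≠ 0 := fun w hw h => by
      have := congrArg re h
      simp at this hw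
      linarith
    refine ⟨Iio (1 / 2), 1, fun w => w / (1 - w), isOpen_Iio, convex_Iio _, one_pos, ?_, ?_, ?_⟩
    · intro w hw
      have h2 := hne w hw
      refine ((hasDerivAt_id w).div ((hasDerivAt_id w).const_sub 1) h2).congr_deriv ?_
      rw [h1]; simp only [id]; push_cast; field_simp; ring
    · intro w hw
      apply hlt
      simp only [normSq_apply, sub_re, one_re, sub_im, one_im]
      have : w.re < 1 / 2 := hw
      linarith
    · intro z hz
      have hz1 := hsq z hz
      have h2 : 1 + z ≠ 0 := fun h => by
        rw [← norm_neg, ← eq_neg_of_add_eq_zero_left h, norm_one] at hz; exact lt_irrefl _ hz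
      refine ⟨z / (1 + z), ?_, ?_⟩
      · have hn : 0 < normSq (1 + z) := normSq_pos.2 h2
        rw [mem_Iio, div_re, ← add_div, div_lt_iff₀ hn, normSq_apply]
        simp only [add_re, add_im, one_re, one_im]
        linarith
      · field_simp; ring
  have hs : 0 < Real.sin θ := Real.sin_pos_of_pos_of_lt_pi h0 hpi
  set T : ℂ := exp (θ * Complex.I) with hT
  have hTre : T.re = Real.cos θ := exp_ofReal_mul_I_re θ
  have hTim : T.im = Real.sin θ := exp_ofReal_mul_I_im θ
  have hcs := Real.sin_sq_add_cos_sq θ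
  have hEim : ∀ w : ℂ, w.re ∈ Ioo 0 Real.pi → 0 < (exp (w * Complex.I)).im := by
    intro w hw
    rw [exp_im]
    have : (w * Complex.I).im = w.re := by simp
    rw [this]
    exact mul_pos (Real.exp_pos _) (Real.sin_pos_of_pos_of_lt_pi hw.1 hw.2)
  -- Since `|T| = 1`, `|1 - E T| = |E - conj T|`: a point of the upper half-plane is closer to `T`
  -- than to its mirror image.
  have hbound : ∀ E : ℂ, 0 < E.im → normSq (T - E) < normSq (1 - E * T) := by
    intro E hE
    simp only [normSq_apply, sub_re, sub_im, one_re, one_im, mul_re, mul_im, hTre, hTim]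
    have := mul_pos hs hE
    have e : (E.re ^ 2 + E.im ^ 2) * (Real.sin θ ^ 2 + Real.cos θ ^ 2) = E.re ^ 2 + E.im ^ 2 := by
      rw [hcs, mul_one]
    linarith
  have hne : ∀ E : ℂ, 0 < E.im → 1 - E * T ≠ 0 := fun E hE =>
    normSq_pos.1 ((normSq_nonneg _).trans_lt (hbound E hE))
  refine ⟨Ioo 0 Real.pi, 1 / (2 * Real.sin θ),
    fun w => (T - exp (w * Complex.I)) / (1 - exp (w * Complex.I) * T), isOpen_Ioo, convex_Ioo _ _,
    by positivity, ?_, fun w hw => hlt _ _ (hbound _ (hEim w hw)), ?_⟩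
  · intro w hw
    have h2 := hne _ (hEim w hw)
    have hE : HasDerivAt (fun w : ℂ => exp (w * Complex.I)) (exp (w * Complex.I) * (1 * Complex.I)) w :=
      ((hasDerivAt_id w).mul_const Complex.I).cexp
    refine ((hE.const_sub T).div ((hE.mul_const T).const_sub 1) h2).congr_deriv ?_
    have hsC : (Real.sin θ : ℂ) ≠ 0 := by exact_mod_cast hs.ne'
    have hTd : T = Real.cos θ + Real.sin θ * Complex.I := by
      rw [hT, exp_mul_I, ofReal_cos, ofReal_sin]
    have hcsC : (Real.sin θ : ℂ) ^ 2 + (Real.cos θ : ℂ) ^ 2 = 1 := by exact_mod_cast hcs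
    have hTq : T ^ 2 = 2 * T * Real.cos θ - 1 := by
      rw [hTd]
      linear_combination (Real.sin θ : ℂ) ^ 2 * I_sq - hcsC
    have hTs : (T ^ 2 - 1) = 2 * Real.sin θ * Complex.I * T := by
      rw [hTd]
      linear_combination (-(Real.sin θ : ℂ) ^ 2) * I_sq + hcsC
    beta_reduce
    generalize exp (w * Complex.I) = E at h2 ⊢
    rw [ofReal_div, ofReal_mul, ofReal_one, ofReal_ofNat]
    generalize (Real.cos θ : ℂ) = C at *
    generalize (Real.sin θ : ℂ) = s at *
    -- The factor `E i (T² - 1)` is the numerator of `Φ'`, so `c = 1 / (2 sin θ)` is forced.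
    have key : (1 - E * T) ^ 2 - 2 * (T - E) * (1 - E * T) * C + (T - E) ^ 2
        = 2 * s * (E * Complex.I * (T ^ 2 - 1)) := by
      linear_combination (1 + E ^ 2 + 2 * E * C) * hTq - 2 * s * E * Complex.I * hTs
        + 4 * E * T * hcsC - 4 * s ^ 2 * E * T * I_sq
    have hN : ∀ N D : ℂ, D ≠ 0 → 1 - 2 * (N / D) * C + (N / D) ^ 2
        = (D ^ 2 - 2 * N * D * C + N ^ 2) / D ^ 2 := fun N D hD => by field_simp
    rw [hN _ _ h2, key, ← mul_div_assoc, div_left_inj' (pow_ne_zero 2 h2)]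
    field_simp
    ring
  · intro z hz
    have hz1 := hsq z hz
    have hD : 1 - z * T ≠ 0 := fun h => by
      have : ‖z * T‖ = 1 := by rw [← sub_eq_zero.1 h, norm_one]
      rw [norm_mul, hT, norm_exp_ofReal_mul_I, mul_one] at this
      linarith
    set E : ℂ := (T - z) / (1 - z * T) with hE
    have hEpos : 0 < E.im := by
      rw [hE, div_im, ← sub_div]
      refine div_pos ?_ (normSq_pos.2 hD)
      simp only [sub_re, sub_im, one_re, one_im, mul_re, mul_im, hTre, hTim]
      have := mul_pos hs (sub_pos.2 hz1)
      have e : z.im * (Real.sin θ ^ 2 + Real.cos θ ^ 2) = z.im := by rw [hcs, mul_one]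
      linarith
    have hE0 : E ≠ 0 := fun h => by simp [h] at hEpos
    refine ⟨-Complex.I * log E, ?_, ?_⟩
    · have : (-Complex.I * log E).re = E.arg := by simp [log_im]
      rw [this]
      refine ⟨lt_of_le_of_ne (arg_nonneg_iff.2 hEpos.le) fun h => ?_,
        lt_of_le_of_ne (arg_le_pi E) fun h => ?_⟩
      · exact hEpos.ne' (arg_eq_zero_iff.1 h.symm).2
      · exact hEpos.ne' (arg_eq_pi_iff.1 h).2
    · have h3 : -Complex.I * log E * Complex.I = log E := by
        linear_combination (-log E) * I_mul_I
      simp only [h3, exp_log hE0]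
      rw [div_eq_iff (hne E hEpos)]
      linear_combination (-1 : ℂ) * div_mul_cancel₀ (T - z) hD

/-! ### Jacobian, `ψ` and its primitive on the disk -/

theorem mem_unitDisk {z : ℂ} : z ∈ unitDisk ↔ ‖z‖ < 1 := mem_ball_zero_iff

theorem isOpen_unitDisk : IsOpen unitDisk := Metric.isOpen_ball

theorem jacobian_harmonicMap {H G : ℂ → ℂ} {a b z : ℂ} (hH : HasDerivAt H a z)
    (hG : HasDerivAt G b z) : jacobian (harmonicMap H G) z = ‖a‖ ^ 2 - ‖b‖ ^ 2 := by
  have h1 := hH.hasFDerivAt.restrictScalars ℝ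
  have h2 := hG.hasFDerivAt.restrictScalars ℝ
  have h3 := h1.add ((conjCLE : ℂ ≃L[ℝ] ℂ).hasFDerivAt.comp z h2)
  have h4 : fderiv ℝ (harmonicMap H G) z = _ := h3.fderiv
  rw [jacobian, h4, ContinuousLinearMap.det, ← LinearMap.det_toMatrix Complex.basisOneI,
    Matrix.det_fin_two, ← normSq_eq_norm_sq, ← normSq_eq_norm_sq, normSq_apply, normSq_apply]
  simp [LinearMap.toMatrix_apply]
  ring

theorem psi_denominator (μ ν : ℝ) (z : ℂ) :
    1 - 2 * z * exp (μ * Complex.I) * (Real.cos ν : ℂ) + z ^ 2 * exp (2 * μ * Complex.I)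
      = 1 - 2 * (z * exp (μ * Complex.I)) * (Real.cos ν : ℂ) + (z * exp (μ * Complex.I)) ^ 2 := by
  have : exp (2 * μ * Complex.I) = exp (μ * Complex.I) ^ 2 := by
    rw [← exp_nat_mul]; congr 1; push_cast; ring
  rw [this]; ring

theorem psi_denominator_ne_zero (μ ν : ℝ) {z : ℂ} (hz : z ∈ unitDisk) :
    1 - 2 * z * exp (μ * Complex.I) * (Real.cos ν : ℂ) + z ^ 2 * exp (2 * μ * Complex.I) ≠ 0 := by
  rw [psi_denominator]
  apply quadratic_ne_zero
  rw [norm_mul, norm_exp_ofReal_mul_I, mul_one]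
  exact mem_unitDisk.1 hz

theorem differentiableOn_psi (μ ν : ℝ) : DifferentiableOn ℂ (psi μ ν) unitDisk := fun z hz => by
  have : DifferentiableAt ℂ (fun z : ℂ => 1 - 2 * z * exp (μ * Complex.I) * (Real.cos ν : ℂ)
      + z ^ 2 * exp (2 * μ * Complex.I)) z := by fun_prop
  exact (this.inv (psi_denominator_ne_zero μ ν hz)).differentiableWithinAt

theorem hasDerivAt_integralFromZero {p : ℂ → ℂ} (hp : DifferentiableOn ℂ p unitDisk) {z : ℂ}
    (hz : z ∈ unitDisk) : HasDerivAt (integralFromZero p) (p z) z := by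
  obtain ⟨Q, hQ⟩ := DifferentiableOn.isExactOn_ball (c := 0) (r := 1) hp
  have key : ∀ w ∈ unitDisk, integralFromZero p w = Q w - Q 0 := by
    intro w hw
    have hmem : ∀ t ∈ uIcc (0 : ℝ) 1, (t : ℂ) * w ∈ unitDisk := by
      intro t ht
      rw [uIcc_of_le zero_le_one] at ht
      rw [mem_unitDisk] at hw ⊢
      rw [norm_mul, norm_real, Real.norm_of_nonneg ht.1]
      exact (mul_le_of_le_one_left (norm_nonneg _) ht.2).trans_lt hw
    have hd : ∀ t ∈ uIcc (0 : ℝ) 1, HasDerivAt (fun t : ℝ => Q (t * w)) (w * p (t * w)) t := by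
      intro t ht
      have h1 : HasDerivAt (fun t : ℝ => (t : ℂ) * w) w t := by
        simpa using ((hasDerivAt_id t).ofReal_comp).mul_const w
      rw [mul_comm w]
      exact (hQ _ (hmem t ht)).comp t h1
    have hc : ContinuousOn (fun t : ℝ => w * p (t * w)) (uIcc (0 : ℝ) 1) := by
      have h2 : ContinuousOn (fun t : ℝ => (t : ℂ) * w) (uIcc (0 : ℝ) 1) := by fun_prop
      exact continuousOn_const.mul (hp.continuousOn.comp h2 hmem)
    rw [integralFromZero, intervalIntegral.integral_eq_sub_of_hasDerivAt hd hc.intervalIntegrable]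
    simp
  exact ((hQ z hz).sub_const (Q 0)).congr_of_eventuallyEq
    (Filter.eventually_of_mem (isOpen_unitDisk.mem_nhds hz) key)

/-! ### From the strip back to the disk -/

/-- A harmonic mapping with `|G'| < |H'|` for which `(H' - e^{-2iμ} G') / psi μ ν` has positive
real part is univalent and convex in the direction `-μ`. -/
theorem univalentOn_and_convexInDirection (μ ν : ℝ) {H G a b : ℂ → ℂ}
    (hH : ∀ z ∈ unitDisk, HasDerivAt H (a z) z) (hG : ∀ z ∈ unitDisk, HasDerivAt G (b z) z)
    (hab : ∀ z ∈ unitDisk, ‖b z‖ < ‖a z‖)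
    (hp : ∀ z ∈ unitDisk, 0 < ((a z - exp (-2 * μ * Complex.I) * b z) / psi μ ν z).re) :
    UnivalentOn (harmonicMap H G) unitDisk ∧
      ConvexInDirection (-μ) (harmonicMap H G '' unitDisk) := by
  obtain ⟨I, c, Φ, hIo, hIc, hc, hΦd, hΦ, hsurj⟩ := exists_strip_parametrization ν
  set u : ℂ := exp (μ * Complex.I) with hu
  set v : ℂ := exp (-(μ * Complex.I)) with hv
  have huv : u * v = 1 := by rw [hu, hv, ← exp_add]; simp
  have hv2 : exp (-2 * μ * Complex.I) = v * v := by
    rw [hv, ← exp_add]; congr 1; ring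
  have hun : ‖u‖ = 1 := norm_exp_ofReal_mul_I μ
  have hvn : ‖v‖ = 1 := by
    have := congrArg norm huv
    rwa [norm_mul, hun, one_mul, norm_one] at this
  have hconj : conj v = u := by
    rw [hv, ← exp_conj, hu]; simp
  set Q : ℂ → ℂ := fun w => 1 - 2 * Φ w * (Real.cos ν : ℂ) + Φ w ^ 2 with hQ
  have hmem : ∀ w : ℂ, w.re ∈ I → v * Φ w ∈ unitDisk := fun w hw => by
    rw [mem_unitDisk, norm_mul, hvn, one_mul]; exact hΦ w hw
  have hpsi : ∀ w : ℂ, psi μ ν (v * Φ w) = (Q w)⁻¹ := fun w => by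
    have : v * Φ w * u = Φ w := by linear_combination Φ w * huv
    rw [psi, psi_denominator, ← hu, this]
  have hcQ : ∀ w : ℂ, w.re ∈ I → (c : ℂ) * Q w ≠ 0 := fun w hw =>
    mul_ne_zero (ofReal_ne_zero.2 hc.ne') (quadratic_ne_zero ν (hΦ w hw))
  have hd : ∀ w : ℂ, w.re ∈ I → HasDerivAt (fun w => v * Φ w) (v * (c * Q w)) w := fun w hw =>
    (hΦd w hw).const_mul v
  -- With `conj v = u`, the map `A + conj B` is `u (H + conj G)` at `v Φ`; multiplying by `u` turns
  -- lines of direction `-μ` horizontal. As `u v = 1`, `A' - B'` is `c` times the quotient assumed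
  -- to have positive real part.
  obtain ⟨hinj, hpre⟩ := injOn_and_isPreconnected_of_strip hIo hIc
    (A := fun w => u * H (v * Φ w)) (B := fun w => v * G (v * Φ w))
    (a := fun w => u * (a (v * Φ w) * (v * (c * Q w))))
    (b := fun w => v * (b (v * Φ w) * (v * (c * Q w))))
    (fun w hw => ((hH _ (hmem w hw)).comp w (hd w hw)).const_mul u)
    (fun w hw => ((hG _ (hmem w hw)).comp w (hd w hw)).const_mul v)
    (fun w hw => by
      have h1 : 0 < ‖(c : ℂ) * Q w‖ := norm_pos_iff.2 (hcQ w hw)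
      simp only [norm_mul, hun, hvn, one_mul] at h1 ⊢
      exact mul_lt_mul_of_pos_right (hab _ (hmem w hw)) h1)
    (fun w hw => by
      have h1 := hp _ (hmem w hw)
      rw [hpsi, div_inv_eq_mul, hv2] at h1
      have e : u * (a (v * Φ w) * (v * (c * Q w))) - v * (b (v * Φ w) * (v * (c * Q w)))
          = (c : ℂ) * ((a (v * Φ w) - v * v * b (v * Φ w)) * Q w) := by
        linear_combination (a (v * Φ w) * c * Q w) * huv
      rw [e, re_ofReal_mul]
      exact mul_pos hc h1)
  have hf : ∀ w, u * H (v * Φ w) + conj (v * G (v * Φ w)) = u * harmonicMap H G (v * Φ w) := by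
    intro w
    rw [map_mul, hconj, harmonicMap]; ring
  simp only [hf] at hinj hpre
  have hsurj' : ∀ z ∈ unitDisk, ∃ w : ℂ, w.re ∈ I ∧ v * Φ w = z := by
    intro z hz
    obtain ⟨w, hw, hwz⟩ := hsurj (u * z) (by rw [norm_mul, hun, one_mul]; exact mem_unitDisk.1 hz)
    exact ⟨w, hw, by rw [hwz]; linear_combination z * huv⟩
  constructor
  · intro z₁ h₁ z₂ h₂ heq
    obtain ⟨w₁, hw₁, rfl⟩ := hsurj' z₁ h₁
    obtain ⟨w₂, hw₂, rfl⟩ := hsurj' z₂ h₂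
    rw [hinj hw₁ hw₂ (congrArg (u * ·) heq)]
  · intro p
    have hdir : exp (((-μ : ℝ) : ℂ) * Complex.I) = v := by rw [hv]; congr 1; push_cast; ring
    have himg : harmonicMap H G '' unitDisk ∩ lineInDirection (-μ) p
        = (fun z => v * z) '' ((fun w => u * harmonicMap H G (v * Φ w)) '' {w : ℂ | w.re ∈ I}
          ∩ {z | z.im = (u * p).im}) := by
      ext q
      simp only [lineInDirection, hdir]
      constructor
      · rintro ⟨⟨z, hz, rfl⟩, t, ht⟩
        obtain ⟨w, hw, rfl⟩ := hsurj' z hz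
        refine ⟨_, ⟨⟨w, hw, rfl⟩, ?_⟩, ?_⟩
        · have e : u * harmonicMap H G (v * Φ w) = u * p + t := by
            rw [← ht]; linear_combination (t : ℂ) * huv
          simp [e]
        · linear_combination harmonicMap H G (v * Φ w) * huv
      · rintro ⟨_, ⟨⟨w, hw, rfl⟩, him⟩, rfl⟩
        have e : v * (u * harmonicMap H G (v * Φ w)) = harmonicMap H G (v * Φ w) := by
          linear_combination harmonicMap H G (v * Φ w) * huv
        refine ⟨⟨_, hmem w hw, e.symm⟩, (u * harmonicMap H G (v * Φ w) - u * p).re, ?_⟩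
        have him0 : (u * harmonicMap H G (v * Φ w) - u * p).im = 0 := by
          rw [sub_im, sub_eq_zero]; exact him
        have hreal : (((u * harmonicMap H G (v * Φ w) - u * p).re : ℝ) : ℂ)
            = u * harmonicMap H G (v * Φ w) - u * p := Complex.ext (by simp) (by simp [him0])
        simp only [hreal]
        linear_combination (-p) * huv
    rw [himg]
    exact (hpre _).image _ (continuous_const.mul continuous_id).continuousOn

/-! ### Linear combinations of shears -/

theorem linComb_harmonicMap (η : ℂ) (h₁ g₁ h₂ g₂ : ℂ → ℂ) :
    linComb η (harmonicMap h₁ g₁) (harmonicMap h₂ g₂)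
      = harmonicMap (fun z => η * h₁ z + (1 - η) * h₂ z)
        (fun z => conj η * g₁ z + (1 - conj η) * g₂ z) := by
  funext z
  simp only [linComb, harmonicMap, map_add, map_mul, map_sub, map_one, conj_conj]
  ring

section ClassH

variable {h g : ℂ → ℂ}

theorem MemClassH.hasDerivAt_h (hf : MemClassH h g) {z : ℂ} (hz : z ∈ unitDisk) :
    HasDerivAt h (deriv h z) z :=
  (hf.analytic_h.differentiableAt (isOpen_unitDisk.mem_nhds hz)).hasDerivAt

theorem MemClassH.hasDerivAt_g (hf : MemClassH h g) {z : ℂ} (hz : z ∈ unitDisk) :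
    HasDerivAt g (deriv g z) z :=
  (hf.analytic_g.differentiableAt (isOpen_unitDisk.mem_nhds hz)).hasDerivAt

theorem MemClassH.norm_deriv_lt (hf : MemClassH h g) {z : ℂ} (hz : z ∈ unitDisk) :
    ‖deriv g z‖ < ‖deriv h z‖ := by
  have := hf.sensePreserving z hz
  rw [jacobian_harmonicMap (hf.hasDerivAt_h hz) (hf.hasDerivAt_g hz), sub_pos] at this
  exact lt_of_pow_lt_pow_left₀ 2 (norm_nonneg _) this

theorem MemClassH.norm_deriv_lt_mul (hf : MemClassH h g) {z : ℂ} (hz : z ∈ unitDisk) {α β : ℝ}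
    (hα : ‖dilatation h g z‖ < α) (hαβ : α ≤ β) : ‖deriv g z‖ < β * ‖deriv h z‖ := by
  -- Sense-preservation makes `h'` nonzero, so the dilatation is a genuine quotient.
  have h0 : 0 < ‖deriv h z‖ := (norm_nonneg _).trans_lt (hf.norm_deriv_lt hz)
  rw [dilatation, norm_div] at hα
  exact (div_lt_iff₀ h0).1 (hα.trans_le hαβ)

theorem MemClassH.deriv_shear (hf : MemClassH h g) {μ ν : ℝ}
    (hshear : ∀ z ∈ unitDisk,
      h z + exp (-2 * μ * Complex.I) * g z = integralFromZero (psi μ ν) z)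
    {z : ℂ} (hz : z ∈ unitDisk) :
    deriv h z + exp (-2 * μ * Complex.I) * deriv g z = psi μ ν z := by
  have h1 := (hf.hasDerivAt_h hz).add ((hf.hasDerivAt_g hz).const_mul (exp (-2 * μ * Complex.I)))
  have h2 := hasDerivAt_integralFromZero (differentiableOn_psi μ ν) hz
  exact h1.unique (h2.congr_of_eventuallyEq
    (Filter.eventually_of_mem (isOpen_unitDisk.mem_nhds hz) hshear))

/-- The normalized co-analytic derivative `e^{-2iμ} g' / psi μ ν` of a shear. -/
theorem MemClassH.norm_div_psi_lt (hf : MemClassH h g) {μ ν : ℝ}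
    (hshear : ∀ z ∈ unitDisk,
      h z + exp (-2 * μ * Complex.I) * g z = integralFromZero (psi μ ν) z)
    {z : ℂ} (hz : z ∈ unitDisk) {β : ℝ} (hβ : ‖deriv g z‖ < β * ‖deriv h z‖) :
    ‖exp (-2 * μ * Complex.I) * deriv g z / psi μ ν z‖
      < β * ‖1 - exp (-2 * μ * Complex.I) * deriv g z / psi μ ν z‖ := by
  have hpsi : psi μ ν z ≠ 0 := inv_ne_zero (psi_denominator_ne_zero μ ν hz)
  have e : 1 - exp (-2 * μ * Complex.I) * deriv g z / psi μ ν z = deriv h z / psi μ ν z := by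
    rw [eq_div_iff hpsi, sub_mul, div_mul_cancel₀ _ hpsi, ← hf.deriv_shear hshear hz]; ring
  have hn : ‖exp (-2 * μ * Complex.I)‖ = 1 := by
    have := norm_exp_ofReal_mul_I (-2 * μ)
    push_cast at this
    exact this
  rw [e, norm_div, norm_div, norm_mul, hn, one_mul, ← mul_div_assoc]
  exact div_lt_div_of_pos_right hβ (norm_pos_iff.2 hpsi)

end ClassH

/-! ### Positivity of the combined real part -/

/-- A disk of Apollonius lies in a vertical strip. -/
theorem re_mem_of_norm_lt_mul {β : ℝ} (hβ0 : 0 < β) (hβ1 : β < 1) {b : ℂ}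
    (h : ‖b‖ < β * ‖1 - b‖) : -(β / (1 - β)) < b.re ∧ b.re < β / (1 + β) := by
  have h1 : ‖1 - b‖ ≤ 1 + ‖b‖ := by simpa using norm_sub_le 1 b
  have h2 := (abs_le.1 (abs_re_le_norm b)).1
  have hsq : ‖b‖ ^ 2 < β ^ 2 * ‖1 - b‖ ^ 2 := by
    rw [← mul_pow]; exact pow_lt_pow_left₀ h (norm_nonneg _) two_ne_zero
  rw [← normSq_eq_norm_sq, ← normSq_eq_norm_sq, normSq_apply, normSq_apply] at hsq
  simp only [sub_re, sub_im, one_re, one_im] at hsq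
  -- The roots of this quadratic are the real endpoints of a diameter of the Apollonius disk;
  -- dropping the `Im b` term only weakens the inequality.
  have hq : ((1 + β) * b.re - β) * ((1 - β) * b.re + β) < 0 := by
    nlinarith [mul_nonneg (by nlinarith : 0 ≤ 1 - β ^ 2) (mul_self_nonneg b.im)]
  have hleft : 0 < (1 - β) * b.re + β := by nlinarith
  constructor
  · rw [← neg_div, div_lt_iff₀ (by linarith)]; linarith
  · rw [lt_div_iff₀ (by linarith)]
    have := neg_of_mul_neg_left hq hleft.le
    linarith

/-- The limiting case `β = 1`: the Apollonius circle becomes the perpendicular bisector of `0` and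
`1`. -/
theorem re_lt_half_of_norm_lt {b : ℂ} (h : ‖b‖ < ‖1 - b‖) : b.re < 1 / 2 := by
  have hsq := pow_lt_pow_left₀ h (norm_nonneg _) two_ne_zero
  rw [← normSq_eq_norm_sq, ← normSq_eq_norm_sq, normSq_apply, normSq_apply] at hsq
  simp only [sub_re, sub_im, one_re, one_im] at hsq
  linarith

/-- A sense-preserving linear combination of two shears of the same function is univalent and
convex in the direction `-μ`, provided a combination of real parts is positive. -/
theorem linComb_univalentOn_and_convexInDirection {μ ν : ℝ} {h₁ g₁ h₂ g₂ : ℂ → ℂ}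
    (hf₁ : MemClassH h₁ g₁) (hf₂ : MemClassH h₂ g₂)
    (hshear₁ : ∀ z ∈ unitDisk,
      h₁ z + exp (-2 * μ * Complex.I) * g₁ z = integralFromZero (psi μ ν) z)
    (hshear₂ : ∀ z ∈ unitDisk,
      h₂ z + exp (-2 * μ * Complex.I) * g₂ z = integralFromZero (psi μ ν) z)
    {η : ℂ}
    (hsp : SensePreservingOn (linComb η (harmonicMap h₁ g₁) (harmonicMap h₂ g₂)) unitDisk)
    (hpos : ∀ z ∈ unitDisk,
      0 < η.re * (1 - 2 * (exp (-2 * μ * Complex.I) * deriv g₁ z / psi μ ν z).re)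
        + (1 - η.re) * (1 - 2 * (exp (-2 * μ * Complex.I) * deriv g₂ z / psi μ ν z).re)) :
    UnivalentOn (linComb η (harmonicMap h₁ g₁) (harmonicMap h₂ g₂)) unitDisk ∧
      ConvexInDirection (-μ)
        (linComb η (harmonicMap h₁ g₁) (harmonicMap h₂ g₂) '' unitDisk) := by
  rw [linComb_harmonicMap] at hsp ⊢
  have hH : ∀ z ∈ unitDisk, HasDerivAt (fun z => η * h₁ z + (1 - η) * h₂ z)
      (η * deriv h₁ z + (1 - η) * deriv h₂ z) z := fun z hz =>
    ((hf₁.hasDerivAt_h hz).const_mul _).add ((hf₂.hasDerivAt_h hz).const_mul _)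
  have hG : ∀ z ∈ unitDisk, HasDerivAt (fun z => conj η * g₁ z + (1 - conj η) * g₂ z)
      (conj η * deriv g₁ z + (1 - conj η) * deriv g₂ z) z := fun z hz =>
    ((hf₁.hasDerivAt_g hz).const_mul _).add ((hf₂.hasDerivAt_g hz).const_mul _)
  refine univalentOn_and_convexInDirection μ ν hH hG (fun z hz => ?_) (fun z hz => ?_)
  · have := hsp z hz
    rw [jacobian_harmonicMap (hH z hz) (hG z hz), sub_pos] at this
    exact lt_of_pow_lt_pow_left₀ 2 (norm_nonneg _) this
  · have hpsi : psi μ ν z ≠ 0 := inv_ne_zero (psi_denominator_ne_zero μ ν hz)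
    have e₁ := hf₁.deriv_shear hshear₁ hz
    have e₂ := hf₂.deriv_shear hshear₂ hz
    have h := hpos z hz
    set ε := exp (-2 * μ * Complex.I)
    set b₁ := ε * deriv g₁ z / psi μ ν z with hb₁
    set b₂ := ε * deriv g₂ z / psi μ ν z with hb₂
    have hc₁ : b₁ * psi μ ν z = ε * deriv g₁ z := div_mul_cancel₀ _ hpsi
    have hc₂ : b₂ * psi μ ν z = ε * deriv g₂ z := div_mul_cancel₀ _ hpsi
    have hη : η + conj η = 2 * (η.re : ℂ) := by rw [add_conj]; push_cast; ring
    have e : (η * deriv h₁ z + (1 - η) * deriv h₂ z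
        - ε * (conj η * deriv g₁ z + (1 - conj η) * deriv g₂ z)) / psi μ ν z
        = (η.re : ℂ) * (1 - 2 * b₁) + ((1 - η.re : ℝ) : ℂ) * (1 - 2 * b₂) := by
      rw [div_eq_iff hpsi]
      push_cast
      linear_combination η * e₁ + (1 - η) * e₂ - (b₁ - b₂) * psi μ ν z * hη
        + (η + conj η) * hc₁ + (2 - η - conj η) * hc₂
    rw [e, add_re, re_ofReal_mul, re_ofReal_mul]
    simpa using h

end HarmonicShear

theorem mainTheorem6 (μ ν : ℝ) (h₁ g₁ h₂ g₂ : ℂ → ℂ)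
    (hf₁ : HarmonicShear.MemClassH h₁ g₁)
    (hf₂ : HarmonicShear.MemClassH h₂ g₂)
    (hshear₁ : ∀ z ∈ HarmonicShear.unitDisk,
      h₁ z + Complex.exp (-2 * μ * Complex.I) * g₁ z
        = HarmonicShear.integralFromZero (HarmonicShear.psi μ ν) z)
    (hshear₂ : ∀ z ∈ HarmonicShear.unitDisk,
      h₂ z + Complex.exp (-2 * μ * Complex.I) * g₂ z
        = HarmonicShear.integralFromZero (HarmonicShear.psi μ ν) z) :
    (∀ η : ℂ, 0 ≤ η.re → η.re ≤ 1 →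
      HarmonicShear.LocallyUnivalentOn (HarmonicShear.linComb η
          (HarmonicShear.harmonicMap h₁ g₁) (HarmonicShear.harmonicMap h₂ g₂)) HarmonicShear.unitDisk →
      HarmonicShear.SensePreservingOn (HarmonicShear.linComb η
          (HarmonicShear.harmonicMap h₁ g₁) (HarmonicShear.harmonicMap h₂ g₂)) HarmonicShear.unitDisk →
        HarmonicShear.UnivalentOn (HarmonicShear.linComb η
          (HarmonicShear.harmonicMap h₁ g₁) (HarmonicShear.harmonicMap h₂ g₂)) HarmonicShear.unitDisk ∧
        HarmonicShear.ConvexInDirection (-μ) (HarmonicShear.linComb η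
          (HarmonicShear.harmonicMap h₁ g₁) (HarmonicShear.harmonicMap h₂ g₂) '' HarmonicShear.unitDisk)) ∧
    (∀ α₁ α₂ : ℝ, α₁ ≤ 1 / 5 → α₂ ≤ 1 / 7 →
      (∀ z ∈ HarmonicShear.unitDisk, ‖HarmonicShear.dilatation h₁ g₁ z‖ < α₁) →
      (∀ z ∈ HarmonicShear.unitDisk, ‖HarmonicShear.dilatation h₂ g₂ z‖ < α₂) →
      ∀ η : ℂ, -1 ≤ η.re → η.re ≤ 1 →
        HarmonicShear.LocallyUnivalentOn (HarmonicShear.linComb η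
          (HarmonicShear.harmonicMap h₁ g₁) (HarmonicShear.harmonicMap h₂ g₂)) HarmonicShear.unitDisk →
        HarmonicShear.SensePreservingOn (HarmonicShear.linComb η
          (HarmonicShear.harmonicMap h₁ g₁) (HarmonicShear.harmonicMap h₂ g₂)) HarmonicShear.unitDisk →
          HarmonicShear.UnivalentOn (HarmonicShear.linComb η
          (HarmonicShear.harmonicMap h₁ g₁) (HarmonicShear.harmonicMap h₂ g₂)) HarmonicShear.unitDisk ∧
          HarmonicShear.ConvexInDirection (-μ) (HarmonicShear.linComb η
          (HarmonicShear.harmonicMap h₁ g₁) (HarmonicShear.harmonicMap h₂ g₂) '' HarmonicShear.unitDisk)) := by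
  have hone : ∀ η : ℂ, 0 ≤ η.re → η.re ≤ 1 → ∀ z ∈ HarmonicShear.unitDisk,
      0 < η.re * (1 - 2 * (Complex.exp (-2 * μ * Complex.I) * deriv g₁ z
          / HarmonicShear.psi μ ν z).re)
        + (1 - η.re) * (1 - 2 * (Complex.exp (-2 * μ * Complex.I) * deriv g₂ z
          / HarmonicShear.psi μ ν z).re) := by
    intro η h0 h1 z hz
    have i₁ := HarmonicShear.re_lt_half_of_norm_lt ((hf₁.norm_div_psi_lt hshear₁ hz
      ((hf₁.norm_deriv_lt hz).trans_eq (one_mul _).symm)).trans_eq (one_mul _))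
    have i₂ := HarmonicShear.re_lt_half_of_norm_lt ((hf₂.norm_div_psi_lt hshear₂ hz
      ((hf₂.norm_deriv_lt hz).trans_eq (one_mul _).symm)).trans_eq (one_mul _))
    rcases h0.eq_or_lt with h | h
    · rw [← h]; linarith
    · exact add_pos_of_pos_of_nonneg (mul_pos h (by linarith))
        (mul_nonneg (by linarith) (by linarith))
  constructor
  · intro η h0 h1 _ hsp
    exact HarmonicShear.linComb_univalentOn_and_convexInDirection hf₁ hf₂ hshear₁ hshear₂ hsp
      (hone η h0 h1)
  · intro α₁ α₂ hα₁ hα₂ hω₁ hω₂ η h0 h1 _ hsp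
    refine HarmonicShear.linComb_univalentOn_and_convexInDirection hf₁ hf₂ hshear₁ hshear₂ hsp ?_
    rcases le_or_gt 0 η.re with h | h
    · exact hone η h h1
    intro z hz
    have i₁ := (HarmonicShear.re_mem_of_norm_lt_mul (by norm_num) (by norm_num)
      (hf₁.norm_div_psi_lt hshear₁ hz (hf₁.norm_deriv_lt_mul hz (hω₁ z hz) hα₁))).1
    have i₂ := (HarmonicShear.re_mem_of_norm_lt_mul (by norm_num) (by norm_num)
      (hf₂.norm_div_psi_lt hshear₂ hz (hf₂.norm_deriv_lt_mul hz (hω₂ z hz) hα₂))).2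
    generalize (Complex.exp (-2 * μ * Complex.I) * deriv g₁ z / HarmonicShear.psi μ ν z).re = x₁
      at i₁ ⊢
    generalize (Complex.exp (-2 * μ * Complex.I) * deriv g₂ z / HarmonicShear.psi μ ν z).re = x₂
      at i₂ ⊢
    norm_num at i₁ i₂
    -- The bounds `1/5` and `1/7` give `x₁ > -1/4` and `x₂ < 1/8`, so for `Re η < 0` the sum
    -- strictly exceeds `(3/2) Re η + (3/4)(1 - Re η) = (3/4)(1 + Re η)`, which is nonnegative
    -- exactly when `Re η ≥ -1`.
    nlinarith [mul_pos_of_neg_of_neg h (by linarith : -(1 / 4) - x₁ < 0),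
      mul_pos (by linarith : 0 < 1 - η.re) (by linarith : 0 < 1 / 8 - x₂)]
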